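/- Let $\mathcal K$ be a finite field, let $\mathbb F_r$ be the free group with standard generators $\gamma_1,\dots,\gamma_r$, and let $\theta_k:\mathbb F_r\to \mathrm{GL}(n_k,\mathcal K)\subset \mathrm{Mat}_{n_k\times n_k}(\mathcal K)$ ($k\ge 1$, $n_k\ge 1$) be a sequence of finite-dimensional linear representations; extend each $\theta_k$ to the group algebra $\mathcal K\mathbb F_r$ and, entrywise, to matrices, so that $\theta_k(A)\in \mathrm{Mat}_{n\times n}(\mathrm{Mat}_{n_k\times n_k}(\mathcal K))\cong\mathrm{Mat}_{nn_k\times nn_k}(\mathcal K)$ for $A\in\mathrm{Mat}_{n\times n}(\mathcal K\mathbb F_r)$. Suppose that the sequence is convergent and satisfies the Atiyah condition, that is, for all $n\ge1$ and all $A\in\mathrm{Mat}_{n\times n}(\mathcal K\mathbb F_r)$ the limit $\lim_{k\to\infty}\frac{1}{n_k}\operatorname{Rank}\theta_k(A)$ exists and is an integer. Let $\theta:\mathbb F_r\to D^\times$ be its limit representation (which is unique up to isomorphism): $D$ is a skew field over $\mathcal K$, the image of $\mathcal K\mathbb F_r$ under the linear extension of $\theta$ generates $D$ as a skew field, and $$\lim_{k\to\infty}\frac{\operatorname{Rank}\theta_k(A)}{n_k}=\operatorname{rk}_D(\theta(A))$$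 for all $n\ge 1$ and $A\in\mathrm{Mat}_{n\times n}(\mathcal K\mathbb F_r)$, where $\operatorname{rk}_D$ is the rank of matrices over the skew field $D$. Then $\{\theta_k\}_{k\ge1}$ is hyperfinite if and only if $D$ is amenable. Here $\{\theta_k\}_{k\ge1}$ is hyperfinite if for every $\epsilon>0$ there is $K_\epsilon>0$ such that for every $k\ge1$ there are $\mathcal K$-linear subspaces $V_1,\dots,V_t\subset\mathcal K^{n_k}$ (with $t$ depending on $k$) such that $\dim_{\mathcal K}V_j\le K_\epsilon$ for all $j$, the subspaces $V_j+\sum_{i=1}^r\theta_k(\gamma_i)V_j$ ($1\le j\le t$) are linearly independent, $\dim_{\mathcal K}\bigl(V_j+\sum_{i=1}^r\theta_k(\gamma_i)V_j\bigr)<(1+\epsilon)\dim_{\mathcal K}V_j$ for all $j$, and $\sum_{j=1}^t\dim_{\mathcal K}V_j\ge(1-\epsilon)n_k$. The skew field $D$ is amenable if for every $\epsilon>0$ and every finite-dimensional $\mathcal K$-subspace $E\subset D$ with $1\in E$ there is a finite-dimensional $\mathcal K$-subspace $V\subset D$ with $\dim_{\mathcal K}EV<(1+\epsilon)\dim_{\mathcal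 K}V$, where $EV$ is the $\mathcal K$-span of the products $ev$, $e\in E$, $v\in V$. -/

import Mathlib

open Filter Topology

noncomputable section

/-- The free group `F_r` on the `r` standard generators `FreeGroup.of i`, `i : Fin r`. -/
abbrev FreeGrp (r : ℕ) : Type := FreeGroup (Fin r)

/-- The extension of a multiplicative map `θ : F_r → S` (with values in the units of the
`K`-algebra `S`, automatically, as `F_r` is a group) to the group algebra `K F_r`. -/
def groupAlgHom {K : Type*} [Field K] {r : ℕ} {S : Type*} [Ring S] [Algebra K S]
    (θ : FreeGrp r →* S) : MonoidAlgebra K (FreeGrp r) →ₐ[K] S :=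
  MonoidAlgebra.lift K S (FreeGrp r) θ

/-- The normalized rank `Rank(θ(A)) / d` of an `n × n` matrix `A` over `K F_r`, where the matrix
`θ(A)` of `d × d` blocks is regarded as an `nd × nd` matrix over `K`. -/
def normRank {K : Type*} [Field K] {r d : ℕ}
    (θ : FreeGrp r →* Matrix (Fin d) (Fin d) K) {n : ℕ}
    (A : Matrix (Fin n) (Fin n) (MonoidAlgebra K (FreeGrp r))) : ℝ :=
  ((Matrix.comp (Fin n) (Fin n) (Fin d) (Fin d) K (A.map (groupAlgHom θ))).rank : ℝ) / (d : ℝ)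

/-- Convergence of a sequence of finite dimensional representations. -/
def IsConvergentSeq {K : Type*} [Field K] {r : ℕ} {d : ℕ → ℕ}
    (θ : ∀ k, FreeGrp r →* Matrix (Fin (d k)) (Fin (d k)) K) : Prop :=
  ∀ (n : ℕ) (A : Matrix (Fin n) (Fin n) (MonoidAlgebra K (FreeGrp r))),
    ∃ l : ℝ, Tendsto (fun k => normRank (θ k) A) atTop (𝓝 l)

/-- The Atiyah condition: all limits of normalized ranks are integers. -/
def AtiyahCondition {K : Type*} [Field K] {r : ℕ} {d : ℕ → ℕ}
    (θ : ∀ k, FreeGrp r →* Matrix (Fin (d k)) (Fin (d k)) K) : Prop :=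
  ∀ (n : ℕ) (A : Matrix (Fin n) (Fin n) (MonoidAlgebra K (FreeGrp r))),
    ∃ z : ℤ, Tendsto (fun k => normRank (θ k) A) atTop (𝓝 (z : ℝ))

/-- The rank of a square matrix over a skew field: the dimension of the left vector space spanned
by its rows (over a noncommutative `D` this is the dimension of the *right* span of the columns,
not of the left one). -/
def skewRank {D : Type*} [DivisionRing D] {n : ℕ} (A : Matrix (Fin n) (Fin n) D) : ℕ :=
  Module.finrank D (Submodule.span D (Set.range A.row))

/-- `φ : F_r → D` is a limit of the sequence `θ`, where `D` is a skew field over `K`. -/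
def IsLimitRep {K : Type*} [Field K] {r : ℕ} {d : ℕ → ℕ}
    (θ : ∀ k, FreeGrp r →* Matrix (Fin (d k)) (Fin (d k)) K)
    {D : Type*} [DivisionRing D] [Algebra K D] (φ : FreeGrp r →* D) : Prop :=
  ∀ (n : ℕ) (A : Matrix (Fin n) (Fin n) (MonoidAlgebra K (FreeGrp r))),
    Tendsto (fun k => normRank (θ k) A) atTop (𝓝 (skewRank (A.map (groupAlgHom (K := K) φ)) : ℝ))

/-- The image of `K F_r` generates `D` as a skew field. (`Subfield D` is Mathlib's type of
division subrings of the possibly noncommutative division ring `D`.) -/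
def IsGenerating (K : Type*) [Field K] {r : ℕ} {D : Type*} [DivisionRing D] [Algebra K D]
    (φ : FreeGrp r →* D) : Prop :=
  Subfield.closure (Set.range (groupAlgHom (K := K) φ)) = ⊤

/-- The subspace `V + ∑ i, θ(γ_i) V` of `K^d`. -/
def genSpan {K : Type*} [Field K] {r d : ℕ} (θ : FreeGrp r →* Matrix (Fin d) (Fin d) K)
    (V : Submodule K (Fin d → K)) : Submodule K (Fin d → K) :=
  V ⊔ ⨆ i : Fin r, V.map (Matrix.toLin' (θ (FreeGroup.of i)))

/-- Hyperfiniteness of a sequence of finite dimensional representations. -/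
def IsHyperfiniteSeq {K : Type*} [Field K] {r : ℕ} {d : ℕ → ℕ}
    (θ : ∀ k, FreeGrp r →* Matrix (Fin (d k)) (Fin (d k)) K) : Prop :=
  ∀ ε : ℝ, 0 < ε → ∃ C : ℕ, 0 < C ∧ ∀ k : ℕ,
    ∃ (t : ℕ) (V : Fin t → Submodule K (Fin (d k) → K)),
      (∀ j, Module.finrank K (V j) ≤ C) ∧
      iSupIndep (fun j => genSpan (θ k) (V j)) ∧
      (∀ j, (Module.finrank K (genSpan (θ k) (V j)) : ℝ) < (1 + ε) * Module.finrank K (V j)) ∧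
      (1 - ε) * (d k : ℝ) ≤ ∑ j, (Module.finrank K (V j) : ℝ)

/-- Amenability of a skew field `D` over `K`; `E * V` is the `K`-span of the products `e * v`. -/
def IsAmenableSkewField (K : Type*) [Field K] (D : Type*) [DivisionRing D] [Algebra K D] : Prop :=
  ∀ ε : ℝ, 0 < ε → ∀ E : Submodule K D, FiniteDimensional K E → (1 : D) ∈ E →
    ∃ V : Submodule K D, FiniteDimensional K V ∧
      (Module.finrank K ↥(E * V) : ℝ) < (1 + ε) * Module.finrank K V

end

/-! A finite model is a subspace `V` of `K^l` with maps `g i` prescribing how the generators move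
`V` into `K^l`; it matters when `l` is barely larger than `dim V`. Its relations form a matrix `P`
over the group algebra. Solutions of `P` in `K^d` are linear maps from `K^l` to `K^d` respecting the
prescribed action on `V`. For a fixed `w` in `K^l`, the values at `w` of all solutions form a
subspace whose normalized dimension tends to the rank increase when the row `w` is added to `φ(P)`.
Over a skew field this is 0 or 1: it is 0 exactly when `w` lies in the left row span
(`IsLimitRep.tendsto_zero`, `IsLimitRep.tendsto_one`).

If `D` is amenable, a Følner subspace yields a model solved injectively inside `D`, so no nonzero
`w` lies in the row span. Solutions in `K^d` then take almost all values at every nonzero `w`, and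
counting over the finite field packs `K^d` with independent injective copies of the model
(`exists_packing`).

If the sequence is hyperfinite, its pieces realize models of bounded size, of which there are
finitely many because `K` is finite. If every such model had a nonzero `w` in its row span, only
`o(d)` independent copies of each would fit, too few to fill `K^d`. So for some model `K^l` embeds
in the quotient of `D^l` by the row span. This gives an almost invariant subspace of a `D`-module,
which descends to `D` through coordinates (`exists_almost_invariant_of_module`). Almost invariance
passes from the generators to all of `D`, as the elements leaving a sequence of subspaces
asymptotically invariant form a division subring. -/

noncomputable section

/-! ### Ranks of rectangular matrices by padding to square ones. -/

/-- The action of a matrix over the group algebra on tuples of vectors. -/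
def blockMap {K : Type*} [Field K] {r d : ℕ} (θ : FreeGrp r →* Matrix (Fin d) (Fin d) K)
    {I : Type*} {l : ℕ} (P : Matrix I (Fin l) (MonoidAlgebra K (FreeGrp r))) :
    (Fin l → Fin d → K) →ₗ[K] (I → Fin d → K) :=
  LinearMap.pi fun a => ∑ b, (groupAlgHom θ (P a b)).mulVecLin ∘ₗ LinearMap.proj b

theorem blockMap_apply {K : Type*} [Field K] {r d : ℕ} (θ : FreeGrp r →* Matrix (Fin d) (Fin d) K)
    {I : Type*} {l : ℕ} (P : Matrix I (Fin l) (MonoidAlgebra K (FreeGrp r)))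
    (f : Fin l → Fin d → K) (a : I) :
    blockMap θ P f a = ∑ b, (groupAlgHom θ (P a b)).mulVec (f b) := by
  simp [blockMap]

/-- The square matrix obtained from a rectangular one by adding zeros. -/
def zeroPad {R : Type*} [Zero R] {I : Type*} {l n : ℕ} (e : I ⊕ Fin l ≃ Fin n)
    (P : Matrix I (Fin l) R) : Matrix (Fin n) (Fin n) R :=
  fun x y => Sum.elim (fun a => Sum.elim 0 (P a) (e.symm y)) 0 (e.symm x)

/-- The padded operator is `blockMap` preceded by a surjection (dropping coordinates) and followed
by an injection (inserting zeros). -/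
theorem rank_comp_zeroPad {K : Type*} [Field K] {r d : ℕ}
    (θ : FreeGrp r →* Matrix (Fin d) (Fin d) K) {I : Type*} {l n : ℕ} (e : I ⊕ Fin l ≃ Fin n)
    (P : Matrix I (Fin l) (MonoidAlgebra K (FreeGrp r))) :
    (Matrix.comp (Fin n) (Fin n) (Fin d) (Fin d) K ((zeroPad e P).map (groupAlgHom θ))).rank =
      Module.finrank K (LinearMap.range (blockMap θ P)) := by
  have hI : Finite I := Finite.of_injective (e ∘ Sum.inl) (e.injective.comp Sum.inl_injective)
  have := Fintype.ofFinite I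
  let p : (Fin n × Fin d → K) →ₗ[K] (Fin l → Fin d → K) :=
    { toFun := fun x b m => x (e (Sum.inr b), m)
      map_add' := fun _ _ => rfl
      map_smul' := fun _ _ => rfl }
  let q : (I → Fin d → K) →ₗ[K] (Fin n × Fin d → K) :=
    { toFun := fun y x => Sum.elim (fun a => y a x.2) 0 (e.symm x.1)
      map_add' := fun y z => by
        ext x; rcases h : e.symm x.1 with a | b <;> simp [h]
      map_smul' := fun c y => by
        ext x; rcases h : e.symm x.1 with a | b <;> simp [h] }
  have hp : Function.Surjective p := fun f =>
    ⟨fun x => Sum.elim 0 (fun b => f b x.2) (e.symm x.1), by ext; simp [p]⟩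
  have hq : Function.Injective q := by
    intro y z h
    ext a m
    simpa [q] using congrFun h (e (Sum.inl a), m)
  have key : (Matrix.comp (Fin n) (Fin n) (Fin d) (Fin d) K
      ((zeroPad e P).map (groupAlgHom θ))).mulVecLin = q ∘ₗ blockMap θ P ∘ₗ p := by
    refine LinearMap.ext fun x => funext fun ⟨i, m⟩ => ?_
    simp only [Matrix.mulVecLin_apply, Matrix.mulVec, dotProduct, Matrix.comp_apply,
      Fintype.sum_prod_type, Matrix.map_apply, LinearMap.comp_apply]
    rw [← e.sum_comp, Fintype.sum_sum_type]
    rcases h : e.symm i with a | b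
    · simp [zeroPad, h, q, blockMap_apply, Matrix.mulVec, dotProduct, p, Finset.sum_apply]
    · simp [zeroPad, h, q]
  rw [Matrix.rank, key, LinearMap.range_comp,
    LinearMap.range_comp_of_range_eq_top _ (LinearMap.range_eq_top.2 hp),
    (Submodule.equivMapOfInjective q hq _).finrank_eq]

theorem skewRank_zeroPad {D : Type*} [DivisionRing D] {I : Type*} {l n : ℕ}
    (e : I ⊕ Fin l ≃ Fin n) (P : Matrix I (Fin l) D) :
    skewRank (zeroPad e P) = Module.finrank D (Submodule.span D (Set.range P.row)) := by
  let q : (Fin l → D) →ₗ[D] (Fin n → D) :=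
    { toFun := fun u y => Sum.elim 0 u (e.symm y)
      map_add' := fun y z => by
        ext x; rcases h : e.symm x with a | b <;> simp [h]
      map_smul' := fun c y => by
        ext x; rcases h : e.symm x with a | b <;> simp [h] }
  have hq : Function.Injective q := by
    intro y z h
    ext a
    simpa [q] using congrFun h (e (Sum.inr a))
  have hs : Submodule.span D (Set.range (zeroPad e P).row) =
      (Submodule.span D (Set.range P.row)).map q := by
    rw [Submodule.map_span]
    refine le_antisymm (Submodule.span_le.2 ?_) (Submodule.span_mono ?_)
    · rintro _ ⟨x, rfl⟩
      rcases h : e.symm x with a | b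
      · refine Submodule.subset_span ⟨P.row a, ⟨a, rfl⟩, ?_⟩
        ext y
        simp [q, zeroPad, h, Matrix.row]
      · have : (zeroPad e P).row x = 0 := by ext y; simp [zeroPad, h, Matrix.row]
        rw [this]
        exact Submodule.zero_mem _
    · rintro _ ⟨_, ⟨a, rfl⟩, rfl⟩
      refine ⟨e (Sum.inl a), ?_⟩
      ext y
      simp [q, zeroPad, Matrix.row]
  rw [skewRank, hs, (Submodule.equivMapOfInjective q hq _).finrank_eq]

theorem zeroPad_map {R S : Type*} [Zero R] [Zero S] {I : Type*} {l n : ℕ}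
    (e : I ⊕ Fin l ≃ Fin n) (P : Matrix I (Fin l) R) (h : R → S) (h0 : h 0 = 0) :
    (zeroPad e P).map h = zeroPad e (P.map h) := by
  ext x y
  rcases hx : e.symm x with a | b <;> rcases hy : e.symm y with a' | b' <;>
    simp [zeroPad, hx, hy, h0]

/-! ### The zero-one law for values of solutions. -/

section Limit

variable {K : Type*} [Field K] {r : ℕ} {d : ℕ → ℕ}
  {θ : ∀ k, FreeGrp r →* Matrix (Fin (d k)) (Fin (d k)) K}
  {D : Type*} [DivisionRing D] [Algebra K D] {φ : FreeGrp r →* D}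

/-- The left span over `D` of the rows of `φ(P)`. -/
def rowSpan (φ : FreeGrp r →* D) {I : Type*} {l : ℕ}
    (P : Matrix I (Fin l) (MonoidAlgebra K (FreeGrp r))) : Submodule D (Fin l → D) :=
  Submodule.span D (Set.range (P.map (groupAlgHom (K := K) φ)).row)

theorem IsLimitRep.tendsto_finrank_range (hlim : IsLimitRep θ φ) {I : Type*} [Finite I] {l : ℕ}
    (P : Matrix I (Fin l) (MonoidAlgebra K (FreeGrp r))) :
    Tendsto (fun k => (Module.finrank K (LinearMap.range (blockMap (θ k) P)) : ℝ) / d k) atTop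
      (𝓝 (Module.finrank D (rowSpan φ P) : ℝ)) := by
  have := Fintype.ofFinite I
  let e := Fintype.equivFin (I ⊕ Fin l)
  have h := hlim _ (zeroPad e P)
  rw [zeroPad_map _ _ _ (map_zero _), skewRank_zeroPad] at h
  simp only [normRank, rank_comp_zeroPad] at h
  exact h

/-- The linear combination of the members of a tuple with given coefficients. -/
def evalAt {l d : ℕ} (w : Fin l → K) : (Fin l → Fin d → K) →ₗ[K] (Fin d → K) :=
  ∑ b, w b • LinearMap.proj b

theorem evalAt_apply {l d : ℕ} (w : Fin l → K) (f : Fin l → Fin d → K) :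
    evalAt w f = ∑ b, w b • f b := by
  simp [evalAt]

/-- The matrix `P` with the additional row `w`. -/
def addRow {I : Type*} {l : ℕ} (P : Matrix I (Fin l) (MonoidAlgebra K (FreeGrp r)))
    (w : Fin l → K) : Matrix (Option I) (Fin l) (MonoidAlgebra K (FreeGrp r)) :=
  fun a b => a.elim (algebraMap K _ (w b)) fun i => P i b

theorem ker_blockMap_addRow {d : ℕ} (θ : FreeGrp r →* Matrix (Fin d) (Fin d) K) {I : Type*}
    {l : ℕ} (P : Matrix I (Fin l) (MonoidAlgebra K (FreeGrp r))) (w : Fin l → K) :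
    LinearMap.ker (blockMap θ (addRow P w)) =
      LinearMap.ker (blockMap θ P) ⊓ LinearMap.ker (evalAt w) := by
  ext f
  rw [Submodule.mem_inf, LinearMap.mem_ker, LinearMap.mem_ker, LinearMap.mem_ker, funext_iff,
    funext_iff, Option.forall, and_comm]
  refine and_congr ?_ ?_
  · simp [blockMap_apply, addRow]
  · rw [blockMap_apply, evalAt_apply]
    simp only [addRow, Option.elim, Algebra.algebraMap_eq_smul_one,
      Matrix.smul_mulVec, Matrix.one_mulVec, map_smul, map_one]
    rfl

theorem rowSpan_addRow {I : Type*} {l : ℕ}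
    (P : Matrix I (Fin l) (MonoidAlgebra K (FreeGrp r))) (w : Fin l → K) :
    rowSpan φ (addRow P w) = Submodule.span D {fun b => algebraMap K D (w b)} ⊔ rowSpan φ P := by
  rw [rowSpan, rowSpan, ← Submodule.span_union]
  congr 1
  ext u
  simp only [Set.mem_range, Option.exists, Set.singleton_union, Set.mem_insert_iff]
  refine or_congr ?_ Iff.rfl
  rw [eq_comm]
  have : ((addRow P w).map (groupAlgHom (K := K) φ)).row none = fun b => algebraMap K D (w b) := by
    ext b
    exact (groupAlgHom (K := K) φ).commutes (w b)
  rw [this]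

/-- The values at `w` of the tuples annihilated by `P`. -/
def solValues {d : ℕ} (θ : FreeGrp r →* Matrix (Fin d) (Fin d) K) {I : Type*}
    {l : ℕ} (P : Matrix I (Fin l) (MonoidAlgebra K (FreeGrp r))) (w : Fin l → K) :
    Submodule K (Fin d → K) :=
  (LinearMap.ker (blockMap θ P)).map (evalAt w)

theorem finrank_map_add_finrank_inf_ker {K V W : Type*} [Field K] [AddCommGroup V] [Module K V]
    [AddCommGroup W] [Module K W] (H : Submodule K V) [FiniteDimensional K H] (f : V →ₗ[K] W) :
    Module.finrank K (H.map f) + Module.finrank K ↥(H ⊓ LinearMap.ker f) = Module.finrank K H := by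
  have h := (f.domRestrict H).finrank_range_add_finrank_ker
  rw [LinearMap.range_domRestrict] at h
  rw [← h]
  congr 1
  have : (H ⊓ LinearMap.ker f) = (LinearMap.ker (f.domRestrict H)).map H.subtype := by
    ext x
    simp [LinearMap.mem_ker, LinearMap.domRestrict_apply, and_comm]
  rw [this, (Submodule.equivMapOfInjective _ H.injective_subtype _).finrank_eq]

/-- Adding the row `w` cuts the solution space down to the solutions vanishing at `w`; by
rank-nullity, the dimension lost is both that of the space of values and the gain in rank. -/
theorem IsLimitRep.tendsto_finrank_solValues (hlim : IsLimitRep θ φ) {I : Type*} [Finite I] {l : ℕ}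
    (P : Matrix I (Fin l) (MonoidAlgebra K (FreeGrp r))) (w : Fin l → K) :
    Tendsto (fun k => (Module.finrank K (solValues (θ k) P w) : ℝ) / d k) atTop
      (𝓝 (Module.finrank D (rowSpan φ (addRow P w)) - Module.finrank D (rowSpan φ P))) := by
  have := Fintype.ofFinite I
  refine ((hlim.tendsto_finrank_range (addRow P w)).sub (hlim.tendsto_finrank_range P)).congr
    fun k => ?_
  rw [← sub_div]
  congr 1
  have h₁ := (blockMap (θ k) P).finrank_range_add_finrank_ker
  have h₂ := (blockMap (θ k) (addRow P w)).finrank_range_add_finrank_ker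
  have h₃ := finrank_map_add_finrank_inf_ker (LinearMap.ker (blockMap (θ k) P))
    (evalAt (K := K) w)
  rw [ker_blockMap_addRow] at h₂
  rw [sub_eq_iff_eq_add]
  norm_cast
  rw [solValues]
  omega

theorem IsLimitRep.tendsto_zero (hlim : IsLimitRep θ φ) {I : Type*} [Finite I] {l : ℕ}
    {P : Matrix I (Fin l) (MonoidAlgebra K (FreeGrp r))} {w : Fin l → K}
    (hw : (fun b => algebraMap K D (w b)) ∈ rowSpan φ P) :
    Tendsto (fun k => (Module.finrank K (solValues (θ k) P w) : ℝ) / d k) atTop (𝓝 0) := by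
  have h := hlim.tendsto_finrank_solValues P w
  rwa [rowSpan_addRow, sup_eq_right.2 (by simpa using hw), sub_self] at h

theorem IsLimitRep.tendsto_one (hlim : IsLimitRep θ φ) {I : Type*} [Finite I] {l : ℕ}
    {P : Matrix I (Fin l) (MonoidAlgebra K (FreeGrp r))} {w : Fin l → K}
    (hw : (fun b => algebraMap K D (w b)) ∉ rowSpan φ P) :
    Tendsto (fun k => (Module.finrank K (solValues (θ k) P w) : ℝ) / d k) atTop (𝓝 1) := by
  have h := hlim.tendsto_finrank_solValues P w
  rw [rowSpan_addRow] at h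
  convert h using 2
  have h₁ := Submodule.finrank_sup_add_finrank_inf_eq
    (Submodule.span D {fun b => algebraMap K D (w b)}) (rowSpan φ P)
  have h0 : (fun b => algebraMap K D (w b)) ≠ 0 := fun h => hw (h ▸ Submodule.zero_mem _)
  rw [(Submodule.disjoint_span_singleton.2 fun h => absurd h hw).symm.eq_bot, finrank_bot,
    finrank_span_singleton h0, add_zero] at h₁
  rw [h₁]
  push_cast
  ring

end Limit

/-! ### Packing independent copies of a model over a finite field. -/

section Packing

/-- Each `N i` has at most a fraction `q^(-l)` of the size of `H`, where `q` is the order of `K`, so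
fewer than `q^l` of them cannot cover `H`. -/
theorem exists_mem_forall_notMem {K M ι : Type*} [Field K] [Finite K] [AddCommGroup M] [Module K M]
    [FiniteDimensional K M] [Fintype ι] {l : ℕ} (hι : Fintype.card ι < Nat.card K ^ l)
    (H : Submodule K M) (N : ι → Submodule K M)
    (hN : ∀ i, Module.finrank K (N i) + l ≤ Module.finrank K H) :
    ∃ f ∈ H, ∀ i, f ∉ N i := by
  by_contra! hcon
  have : Finite M := Module.finite_of_finite K
  have hq : 0 < Nat.card K := Nat.card_pos
  have hsub : (H : Set M) ⊆ ⋃ i ∈ Finset.univ, (N i : Set M) := by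
    intro f hf
    simpa using hcon f hf
  have h₁ := (Set.ncard_le_ncard hsub (Set.toFinite _)).trans (Finset.set_ncard_biUnion_le _ _)
  have hc : ∀ L : Submodule K M, (L : Set M).ncard = Nat.card K ^ Module.finrank K L := fun L => by
    rw [← Module.natCard_eq_pow_finrank (K := K) (V := L)]
    rfl
  simp only [hc] at h₁
  obtain hι0 | ⟨⟨i₀⟩⟩ := isEmpty_or_nonempty ι
  · simp only [Finset.univ_eq_empty, Finset.sum_empty, nonpos_iff_eq_zero] at h₁
    exact (pow_pos hq _).ne' h₁
  have hl : l ≤ Module.finrank K H := (Nat.le_add_left _ _).trans (hN i₀)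
  have h₂ : ∑ i, Nat.card K ^ Module.finrank K (N i) ≤
      Fintype.card ι * Nat.card K ^ (Module.finrank K H - l) := by
    rw [← smul_eq_mul, Fintype.card, ← Finset.sum_const]
    exact Finset.sum_le_sum fun i _ => Nat.pow_le_pow_right hq (by have := hN i; omega)
  have h₃ := Nat.mul_lt_mul_of_pos_right hι (pow_pos hq (Module.finrank K H - l))
  rw [← pow_add, Nat.add_sub_cancel' hl] at h₃
  exact absurd (h₁.trans h₂) (not_le.2 h₃)

variable {K : Type*} [Field K] {r l d : ℕ}

theorem evalAt_eq_linearCombination (w : Fin l → K) (f : Fin l → Fin d → K) :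
    evalAt w f = Fintype.linearCombination K f w := by
  rw [evalAt_apply, Fintype.linearCombination_apply]

/-- The matrix of the relations `γ_i v = g_i(v)`, for `v ∈ V`. -/
def relMatrix (V : Submodule K (Fin l → K)) (g : Fin r → (Fin l → K) → (Fin l → K)) :
    Matrix (Fin r × V) (Fin l) (MonoidAlgebra K (FreeGrp r)) :=
  fun a b => MonoidAlgebra.single (FreeGroup.of a.1) ((a.2 : Fin l → K) b) -
    algebraMap K _ (g a.1 a.2 b)

theorem groupAlgHom_relMatrix {S : Type*} [Ring S] [Algebra K S] (ψ : FreeGrp r →* S)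
    (V : Submodule K (Fin l → K)) (g : Fin r → (Fin l → K) → (Fin l → K)) (a : Fin r × V)
    (b : Fin l) : groupAlgHom ψ (relMatrix V g a b) =
      (a.2 : Fin l → K) b • ψ (FreeGroup.of a.1) - g a.1 a.2 b • 1 := by
  rw [relMatrix, map_sub, AlgHom.commutes, Algebra.algebraMap_eq_smul_one, groupAlgHom,
    MonoidAlgebra.lift_single]

theorem mem_ker_relMatrix {θ : FreeGrp r →* Matrix (Fin d) (Fin d) K}
    {V : Submodule K (Fin l → K)} {g : Fin r → (Fin l → K) → (Fin l → K)}
    {f : Fin l → Fin d → K} :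
    f ∈ LinearMap.ker (blockMap θ (relMatrix V g)) ↔
      ∀ i, ∀ v ∈ V, (θ (FreeGroup.of i)).mulVec (Fintype.linearCombination K f v) =
        Fintype.linearCombination K f (g i v) := by
  rw [LinearMap.mem_ker, funext_iff, Prod.forall]
  refine forall_congr' fun i => ?_
  rw [Subtype.forall]
  refine forall₂_congr fun v hv => ?_
  rw [blockMap_apply, Pi.zero_apply, ← sub_eq_zero (b := Fintype.linearCombination K f (g i v))]
  simp only [groupAlgHom_relMatrix, Matrix.sub_mulVec, Finset.sum_sub_distrib, Matrix.smul_mulVec,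
    Matrix.one_mulVec, Fintype.linearCombination_apply, Matrix.mulVec_sum, Matrix.mulVec_smul]

theorem genSpan_map_le {θ : FreeGrp r →* Matrix (Fin d) (Fin d) K}
    {V : Submodule K (Fin l → K)} {g : Fin r → (Fin l → K) → (Fin l → K)}
    {f : Fin l → Fin d → K} (hf : f ∈ LinearMap.ker (blockMap θ (relMatrix V g))) :
    genSpan θ (V.map (Fintype.linearCombination K f)) ≤
      LinearMap.range (Fintype.linearCombination K f) := by
  refine sup_le LinearMap.map_le_range (iSup_le fun i => ?_)
  rintro _ ⟨_, ⟨v, hv, rfl⟩, rfl⟩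
  exact ⟨g i v, by rw [Matrix.toLin'_apply, mem_ker_relMatrix.1 hf i v hv]⟩

/-- Bounds below the codimension in `H` of the elements sent into `U`; in the packing these are the
solutions whose value at some `w` falls into the space already filled. -/
theorem finrank_inf_comap_le {M N : Type*} [AddCommGroup M] [Module K M]
    [FiniteDimensional K M] [AddCommGroup N] [Module K N] [FiniteDimensional K N]
    (H : Submodule K M) (U : Submodule K N) (f : M →ₗ[K] N) :
    Module.finrank K ↥(H ⊓ U.comap f) + Module.finrank K (H.map f) ≤
      Module.finrank K H + Module.finrank K U := by
  have h₁ := finrank_map_add_finrank_inf_ker H f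
  have h₂ := finrank_map_add_finrank_inf_ker (H ⊓ U.comap f) f
  have h₃ : Module.finrank K ((H ⊓ U.comap f).map f) ≤ Module.finrank K U :=
    Submodule.finrank_mono ((Submodule.map_mono inf_le_right).trans (Submodule.map_comap_le _ _))
  have h₄ : Module.finrank K ↥(H ⊓ U.comap f ⊓ LinearMap.ker f) ≤
      Module.finrank K ↥(H ⊓ LinearMap.ker f) :=
    Submodule.finrank_mono (inf_le_inf_right _ inf_le_left)
  omega

theorem finrank_finset_sup_le {M ι : Type*} [AddCommGroup M] [Module K M] [FiniteDimensional K M]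
    (s : Finset ι) (N : ι → Submodule K M) :
    Module.finrank K ↥(s.sup N) ≤ ∑ i ∈ s, Module.finrank K (N i) := by
  classical
  induction s using Finset.induction_on with
  | empty => simp
  | insert i s hi ih =>
    rw [Finset.sup_insert, Finset.sum_insert hi]
    exact (Submodule.finrank_add_le_finrank_add_finrank _ _).trans (by gcongr)

/-- If the tuples annihilated by `P` take many values at each nonzero `w`, then independent copies
of `K^l` fill a large part of `K^d`. -/
theorem exists_packing [Finite K] (hl : 0 < l) {θ : FreeGrp r →* Matrix (Fin d) (Fin d) K}
    {I : Type*} (P : Matrix I (Fin l) (MonoidAlgebra K (FreeGrp r))) (c : ℝ)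
    (h : ∀ w : Fin l → K, w ≠ 0 → l + c ≤ Module.finrank K (solValues θ P w)) :
    ∃ s : Finset (Fin l → Fin d → K),
      (∀ f ∈ s, f ∈ LinearMap.ker (blockMap θ P) ∧
        Function.Injective (Fintype.linearCombination K f)) ∧
      s.SupIndep (fun f => LinearMap.range (Fintype.linearCombination K f)) ∧
      c ≤ s.card * l := by
  classical
  have := Fintype.ofFinite K
  let R : (Fin l → Fin d → K) → Submodule K (Fin d → K) :=
    fun f => LinearMap.range (Fintype.linearCombination K f)
  let G : Set (Finset (Fin l → Fin d → K)) := {s | (∀ f ∈ s, f ∈ LinearMap.ker (blockMap θ P) ∧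
    Function.Injective (Fintype.linearCombination K f)) ∧ s.SupIndep R}
  have hG : (∅ : Finset (Fin l → Fin d → K)) ∈ G := by simp [G]
  obtain ⟨s, hs⟩ := (Set.toFinite G).exists_maximal ⟨_, hG⟩
  refine ⟨s, hs.1.1, hs.1.2, ?_⟩
  by_contra! hcon
  have hU : Module.finrank K ↥(s.sup R) ≤ s.card * l := by
    refine (finrank_finset_sup_le s R).trans ?_
    rw [← smul_eq_mul, ← Finset.sum_const]
    refine Finset.sum_le_sum fun f _ => ?_
    simpa using LinearMap.finrank_range_le (Fintype.linearCombination K f)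
  have hU' : (Module.finrank K ↥(s.sup R) : ℝ) < c := lt_of_le_of_lt (by exact_mod_cast hU) hcon
  -- There are only `q^l - 1` nonzero `w`, so some solution avoids `s.sup R` at all of them at once;
  -- this gives both injectivity and independence from `s`.
  obtain ⟨f, hf, hfU⟩ := exists_mem_forall_notMem (K := K) (ι := {w : Fin l → K // w ≠ 0}) (l := l)
    (by
      have : Nat.card K ^ l = Fintype.card (Fin l → K) := by simp
      rw [this]
      exact Fintype.card_subtype_lt (x := 0) (by simp))
    (LinearMap.ker (blockMap θ P))
    (fun w => LinearMap.ker (blockMap θ P) ⊓ (s.sup R).comap (evalAt w.1)) (fun w => by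
      have h₁ := finrank_inf_comap_le (LinearMap.ker (blockMap θ P)) (s.sup R) (evalAt w.1)
      have h₂ := h w.1 w.2
      rw [solValues] at h₂
      have h₃ : l + Module.finrank K ↥(s.sup R) <
        Module.finrank K ((LinearMap.ker (blockMap θ P)).map (evalAt w.1)) := by
        exact_mod_cast (add_lt_add_right hU' (l : ℝ)).trans_le h₂
      omega)
  have hfU' : ∀ w : Fin l → K, Fintype.linearCombination K f w ∈ s.sup R → w = 0 := by
    intro w hw
    by_contra hw0
    refine hfU ⟨w, hw0⟩ ⟨hf, ?_⟩
    change evalAt w f ∈ s.sup R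
    rwa [evalAt_eq_linearCombination]
  have hinj : Function.Injective (Fintype.linearCombination K f) := by
    rw [← LinearMap.ker_eq_bot, LinearMap.ker_eq_bot']
    intro w hw
    exact hfU' w (hw ▸ Submodule.zero_mem _)
  have hdis : Disjoint (R f) (s.sup R) := by
    rw [Submodule.disjoint_def]
    rintro _ ⟨w, rfl⟩ hw
    rw [hfU' w hw, map_zero]
  have hins : insert f s ∈ G := ⟨by
    intro f' hf'
    rcases Finset.mem_insert.1 hf' with rfl | hf'
    exacts [⟨hf, hinj⟩, hs.1.1 f' hf'], hs.1.2.insert hdis⟩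
  have hfs : f ∈ s := hs.le_of_ge hins (Finset.subset_insert f s) (Finset.mem_insert_self f s)
  have hle : R f ≤ s.sup R := Finset.le_sup (f := R) hfs
  have hone := hfU' (fun _ => 1) (hle ⟨_, rfl⟩)
  exact one_ne_zero (congrFun hone ⟨0, hl⟩)

end Packing

/-! ### From amenability to hyperfiniteness. -/

section Hyperfinite

variable {K : Type*} [Field K] {r : ℕ} {d : ℕ → ℕ}
  {θ : ∀ k, FreeGrp r →* Matrix (Fin (d k)) (Fin (d k)) K}
  {D : Type*} [DivisionRing D] [Algebra K D] {φ : FreeGrp r →* D}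

theorem row_groupAlgHom_relMatrix {l : ℕ} (V : Submodule K (Fin l → K))
    (g : Fin r → (Fin l → K) → (Fin l → K)) (a : Fin r × V) :
    ((relMatrix V g).map (groupAlgHom (K := K) φ)).row a =
      φ (FreeGroup.of a.1) • (fun b => algebraMap K D ((a.2 : Fin l → K) b)) -
        fun b => algebraMap K D (g a.1 a.2 b) := by
  ext b
  refine (groupAlgHom_relMatrix φ V g a b).trans ?_
  simp [Algebra.smul_def, Algebra.commutes]

theorem linearCombination_algebraMap {l : ℕ} (x : Fin l → D) (w : Fin l → K) :
    Fintype.linearCombination D x (fun b => algebraMap K D (w b)) =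
      Fintype.linearCombination K x w := by
  simp [Fintype.linearCombination_apply, Algebra.smul_def]

/-- A solution `x` in `D` defines a left `D`-linear functional that kills every row of relations,
hence their span, but not `w`. -/
theorem notMem_rowSpan {l : ℕ} {V : Submodule K (Fin l → K)}
    {g : Fin r → (Fin l → K) → (Fin l → K)} {x : Fin l → D}
    (hx : ∀ i, ∀ v ∈ V, φ (FreeGroup.of i) * Fintype.linearCombination K x v =
      Fintype.linearCombination K x (g i v))
    {w : Fin l → K} (hw : Fintype.linearCombination K x w ≠ 0) :
    (fun b => algebraMap K D (w b)) ∉ rowSpan φ (relMatrix V g) := by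
  intro hmem
  have hle : rowSpan φ (relMatrix V g) ≤ LinearMap.ker (Fintype.linearCombination D x) := by
    refine Submodule.span_le.2 ?_
    rintro _ ⟨a, rfl⟩
    rw [row_groupAlgHom_relMatrix, SetLike.mem_coe, LinearMap.mem_ker, map_sub, map_smul,
      linearCombination_algebraMap, linearCombination_algebraMap, smul_eq_mul, hx _ _ a.2.2,
      sub_self]
  have := hle hmem
  rw [LinearMap.mem_ker, linearCombination_algebraMap] at this
  exact hw this

/-- Local models in `D` of the action of the generators on a subspace with small boundary. -/
theorem IsAmenableSkewField.exists_model (h : IsAmenableSkewField K D) (φ : FreeGrp r →* D)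
    {η : ℝ} (hη : 0 < η) :
    ∃ (l : ℕ) (V : Submodule K (Fin l → K)) (g : Fin r → (Fin l → K) → (Fin l → K)),
      0 < l ∧ (l : ℝ) < (1 + η) * Module.finrank K V ∧
      ∀ w : Fin l → K, w ≠ 0 → (fun b => algebraMap K D (w b)) ∉ rowSpan φ (relMatrix V g) := by
  classical
  let E : Submodule K D := Submodule.span K (insert 1 (Set.range fun i => φ (FreeGroup.of i)))
  have hE1 : (1 : D) ∈ E := Submodule.subset_span (Set.mem_insert _ _)
  have hEfin : FiniteDimensional K E :=
    FiniteDimensional.span_of_finite K ((Set.finite_range _).insert _)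
  obtain ⟨V, hVfin, hV⟩ := h η hη E hEfin hE1
  let W : Submodule K D := E * V
  have hWfin : FiniteDimensional K W := Module.Finite.iff_fg.2
    ((Module.Finite.iff_fg.1 hEfin).mul (Module.Finite.iff_fg.1 hVfin))
  have hVW : V ≤ W := fun v hv => by simpa using Submodule.mul_mem_mul hE1 hv
  let l := Module.finrank K W
  let β : (Fin l → K) ≃ₗ[K] W := (Module.finBasis K W).equivFun.symm
  let x : Fin l → D := fun b => Module.finBasis K W b
  have hβ : ∀ w, Fintype.linearCombination K x w = β w := fun w => by
    simp [β, x, Fintype.linearCombination_apply, Module.Basis.equivFun_symm_apply]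
    rfl
  let ι : (Fin l → K) →ₗ[K] D := W.subtype ∘ₗ β.toLinearMap
  have hι : Function.Injective ι := W.injective_subtype.comp β.injective
  have hVι : (V.comap ι).map ι = V := by
    rw [Submodule.map_comap_eq, inf_eq_right]
    exact fun v hv => ⟨β.symm ⟨v, hVW hv⟩, by simp [ι]⟩
  have hVdim : Module.finrank K (V.comap ι) = Module.finrank K V := by
    rw [(Submodule.equivMapOfInjective ι hι (V.comap ι)).finrank_eq, hVι]
  -- The default value 0 is harmless: the relations use only vectors coming from `V`, whose products
  -- with the generators lie in `W`.
  let g : Fin r → (Fin l → K) → (Fin l → K) := fun i u =>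
    if h : φ (FreeGroup.of i) * β u ∈ W then β.symm ⟨_, h⟩ else 0
  refine ⟨l, V.comap ι, g, ?_, by rwa [hVdim], fun w hw => ?_⟩
  · refine Nat.pos_of_ne_zero fun hl => ?_
    have h₁ : Module.finrank K V ≤ l := Submodule.finrank_mono hVW
    have h₂ : Module.finrank K V = 0 := by omega
    have h₃ : (0 : ℝ) ≤ Module.finrank K W := Nat.cast_nonneg _
    rw [h₂, Nat.cast_zero, mul_zero] at hV
    exact absurd hV (not_lt.2 h₃)
  · refine notMem_rowSpan (x := x) (fun i v hv => ?_) ?_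
    · have hmem : φ (FreeGroup.of i) * β v ∈ W :=
        Submodule.mul_mem_mul (Submodule.subset_span (Set.mem_insert_of_mem _ ⟨i, rfl⟩)) hv
      rw [hβ, hβ]
      simp [g, hmem]
    · rw [hβ]
      exact fun h => hw (hι (by simpa [ι] using h))

theorem IsLimitRep.isHyperfiniteSeq [Finite K] (hd : ∀ k, 0 < d k) (hlim : IsLimitRep θ φ)
    (h : IsAmenableSkewField K D) : IsHyperfiniteSeq θ := by
  classical
  intro ε hε
  have hη : 0 < ε / 2 := half_pos hε
  set η := ε / 2 with hηdef
  obtain ⟨l, V, g, hl, hlV, hrow⟩ := h.exists_model φ hη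
  have hev : ∀ᶠ k in atTop, ∀ w : Fin l → K, w ≠ 0 →
      (1 - η / 2) < (Module.finrank K (solValues (θ k) (relMatrix V g) w) : ℝ) / d k := by
    rw [eventually_all]
    intro w
    by_cases hw : w = 0
    · simp [hw]
    · filter_upwards [(hlim.tendsto_one (hrow w hw)).eventually_const_lt
        (show 1 - η / 2 < 1 by linarith)] with k hk _ using hk
  obtain ⟨k₀, hk₀⟩ := eventually_atTop.1 hev
  -- Once `d k` exceeds this, `(η / 2) * d k` absorbs the summand `l` required by `exists_packing`.
  let N := ⌈2 * l / η⌉₊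
  -- The bound covers the model pieces and also the spaces that are small or occur before `k₀`, for
  -- which the whole space serves as one piece.
  refine ⟨l + N + ∑ k ∈ Finset.range k₀, d k, by omega, fun k => ?_⟩
  have hdk : (0 : ℝ) < d k := by exact_mod_cast hd k
  by_cases hk : k₀ ≤ k ∧ N < d k
  · obtain ⟨hk, hN⟩ := hk
    have hN' : 2 * l / η < d k := (Nat.le_ceil _).trans_lt (Nat.cast_lt.2 hN)
    rw [div_lt_iff₀ hη] at hN'
    obtain ⟨s, hs, hind, hcard⟩ := exists_packing hl (relMatrix V g) (θ := θ k) ((1 - η) * d k)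
      (fun w hw => by
        have := hk₀ k hk w hw
        rw [lt_div_iff₀ hdk] at this
        nlinarith)
    let e := s.equivFin.symm
    have hfin : ∀ f ∈ s, Module.finrank K (V.map (Fintype.linearCombination K f)) =
        Module.finrank K V := fun f hf =>
      (Submodule.equivMapOfInjective _ (hs f hf).2 V).finrank_eq.symm
    have hVl : Module.finrank K V ≤ l := by simpa using Submodule.finrank_le V
    refine ⟨s.card, fun j => V.map (Fintype.linearCombination K (e j).1), fun j => ?_, ?_,
      fun j => ?_, ?_⟩
    · rw [hfin _ (e j).2]
      omega
    · exact ((iSupIndep_comp_coe_iff_supIndep.2 hind).comp e.injective).mono fun j =>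
        genSpan_map_le (hs _ (e j).2).1
    · rw [hfin _ (e j).2]
      refine lt_of_le_of_lt (Nat.cast_le.2 ((Submodule.finrank_mono
        (genSpan_map_le (hs _ (e j).2).1)).trans (LinearMap.finrank_range_le _))) ?_
      rw [Module.finrank_fin_fun]
      refine hlV.trans_le ?_
      gcongr
      linarith
    · simp only [hfin _ (e _).2, Finset.sum_const, Finset.card_univ, Fintype.card_fin,
        nsmul_eq_mul]
      have h₁ : (1 - η) * d k ≤ (1 + η) * (s.card * Module.finrank K V) := by
        refine hcard.trans ?_
        rw [mul_left_comm]
        gcongr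
      have h₂ : (1 - 2 * η) * d k * (1 + η) ≤ (1 - η) * d k := by nlinarith [sq_nonneg η]
      have h₃ : ε = 2 * η := by rw [hηdef]; ring
      rw [h₃]
      refine le_of_mul_le_mul_right (h₂.trans (h₁.trans_eq (mul_comm _ _))) (by linarith)
  · refine ⟨1, fun _ => ⊤, fun _ => ?_, iSupIndep_subsingleton _, fun _ => ?_, ?_⟩
    · rw [finrank_top, Module.finrank_fin_fun]
      rw [not_and_or, not_le, not_lt] at hk
      rcases hk with hk | hk
      · have := Finset.single_le_sum (f := d) (fun _ _ => Nat.zero_le _) (Finset.mem_range.2 hk)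
        omega
      · omega
    · rw [genSpan, top_sup_eq, finrank_top, Module.finrank_fin_fun]
      nlinarith
    · simp only [finrank_top, Module.finrank_fin_fun, Finset.univ_unique, Finset.sum_const,
        Finset.card_singleton, one_smul]
      nlinarith

end Hyperfinite

/-! ### Almost invariant subspaces of skew fields and of modules over them. -/

section Amenable

theorem finrank_sup_add_le {K M : Type*} [Field K] [AddCommGroup M] [Module K M]
    {A B C : Submodule K M} [FiniteDimensional K A] [FiniteDimensional K B] (hA : C ≤ A)
    (hB : C ≤ B) :
    Module.finrank K ↥(A ⊔ B) + Module.finrank K C ≤ Module.finrank K A + Module.finrank K B := by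
  rw [← Submodule.finrank_sup_add_finrank_inf_eq A B]
  have : FiniteDimensional K ↥(A ⊓ B) := Submodule.finiteDimensional_of_le inf_le_left
  exact Nat.add_le_add_left (Submodule.finrank_mono (le_inf hA hB)) _

variable {K : Type*} [Field K] {D : Type*} [DivisionRing D] [Algebra K D]

/-- The subspace `V + x V`. -/
def addMul (x : D) (V : Submodule K D) : Submodule K D := V ⊔ V.map (LinearMap.mulLeft K x)

theorem le_addMul (x : D) (V : Submodule K D) : V ≤ addMul x V := le_sup_left

theorem map_mulLeft_mul (x y : D) (V : Submodule K D) :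
    V.map (LinearMap.mulLeft K (x * y)) =
      (V.map (LinearMap.mulLeft K y)).map (LinearMap.mulLeft K x) := by
  rw [← Submodule.map_comp, LinearMap.mulLeft_mul]

theorem finrank_map_mulLeft {x : D} (hx : x ≠ 0) (V : Submodule K D) :
    Module.finrank K (V.map (LinearMap.mulLeft K x)) = Module.finrank K V :=
  (Submodule.equivMapOfInjective _ (mul_right_injective₀ hx) V).finrank_eq.symm

instance finiteDimensional_addMul (x : D) (V : Submodule K D) [FiniteDimensional K V] :
    FiniteDimensional K (addMul x V) := by
  unfold addMul
  infer_instance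

theorem finrank_addMul_add (x y : D) (V : Submodule K D) [FiniteDimensional K V] :
    Module.finrank K (addMul (x + y) V) + Module.finrank K V ≤
      Module.finrank K (addMul x V) + Module.finrank K (addMul y V) := by
  refine (Nat.add_le_add_right (Submodule.finrank_mono ?_) _).trans
    (finrank_sup_add_le (le_addMul x V) (le_addMul y V))
  refine sup_le ((le_addMul x V).trans le_sup_left) ?_
  rintro _ ⟨v, hv, rfl⟩
  rw [LinearMap.mulLeft_apply, add_mul]
  exact Submodule.add_mem_sup (Submodule.mem_sup_right ⟨v, hv, rfl⟩)
    (Submodule.mem_sup_right ⟨v, hv, rfl⟩)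

/-- For `x ≠ 0`, the spaces `V + xV` and `x(V + yV)` share `xV`, and their sum contains `V + xyV`.
-/
theorem finrank_addMul_mul (x y : D) (V : Submodule K D) [FiniteDimensional K V] :
    Module.finrank K (addMul (x * y) V) + Module.finrank K V ≤
      Module.finrank K (addMul x V) + Module.finrank K (addMul y V) := by
  obtain rfl | hx := eq_or_ne x 0
  · have : addMul (0 * y) V = V := by simp [addMul]
    have h0 : addMul 0 V = V := by simp [addMul]
    rw [this, h0]
    exact Nat.add_le_add_left (Submodule.finrank_mono (le_addMul y V)) _
  rw [← finrank_map_mulLeft hx V, ← finrank_map_mulLeft hx (addMul y V)]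
  refine (Nat.add_le_add_right (Submodule.finrank_mono ?_) _).trans (finrank_sup_add_le
    (A := addMul x V) (B := (addMul y V).map (LinearMap.mulLeft K x)) le_sup_right
    (Submodule.map_mono (le_addMul y V)))
  refine sup_le ((le_addMul x V).trans le_sup_left) ?_
  rw [map_mulLeft_mul]
  exact (Submodule.map_mono le_sup_right).trans le_sup_right

/-- Multiplication by a nonzero `x` carries `V + x⁻¹V` onto `xV + V`. -/
theorem finrank_addMul_inv (x : D) (V : Submodule K D) :
    Module.finrank K (addMul x⁻¹ V) = Module.finrank K (addMul x V) := by
  obtain rfl | hx := eq_or_ne x 0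
  · rw [inv_zero]
  rw [← finrank_map_mulLeft hx (addMul x⁻¹ V), addMul, Submodule.map_sup, ← map_mulLeft_mul,
    mul_inv_cancel₀ hx, LinearMap.mulLeft_one, Submodule.map_id, sup_comm, addMul]

theorem finrank_addMul_algebraMap (c : K) (V : Submodule K D) :
    Module.finrank K (addMul (algebraMap K D c) V) = Module.finrank K V := by
  rw [addMul, sup_eq_left.2]
  rintro _ ⟨v, hv, rfl⟩
  rw [LinearMap.mulLeft_apply, ← Algebra.smul_def]
  exact V.smul_mem c hv

theorem one_le_addMul_div (x : D) {V : Submodule K D} [FiniteDimensional K V]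
    (hpos : 0 < Module.finrank K V) :
    1 ≤ (Module.finrank K (addMul x V) : ℝ) / Module.finrank K V := by
  rw [one_le_div (Nat.cast_pos.2 hpos)]
  exact Nat.cast_le.2 (Submodule.finrank_mono (le_addMul _ _))

theorem tendsto_addMul_div {V : ℕ → Submodule K D} (hfin : ∀ n, FiniteDimensional K (V n))
    (hpos : ∀ n, 0 < Module.finrank K (V n)) {x y z : D}
    (hx : Tendsto (fun n => (Module.finrank K (addMul x (V n)) : ℝ) / Module.finrank K (V n))
      atTop (𝓝 1))
    (hy : Tendsto (fun n => (Module.finrank K (addMul y (V n)) : ℝ) / Module.finrank K (V n))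
      atTop (𝓝 1))
    (hz : ∀ n, Module.finrank K (addMul z (V n)) + Module.finrank K (V n) ≤
      Module.finrank K (addMul x (V n)) + Module.finrank K (addMul y (V n))) :
    Tendsto (fun n => (Module.finrank K (addMul z (V n)) : ℝ) / Module.finrank K (V n))
      atTop (𝓝 1) := by
  have h := (hx.add hy).sub_const 1
  norm_num at h
  refine tendsto_of_tendsto_of_tendsto_of_le_of_le tendsto_const_nhds h
    (fun n => one_le_addMul_div z (hpos n)) fun n => ?_
  have hv : (0 : ℝ) < Module.finrank K (V n) := Nat.cast_pos.2 (hpos n)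
  dsimp only
  rw [← add_div, le_sub_iff_add_le, div_add_one hv.ne', div_le_div_iff_of_pos_right hv]
  exact_mod_cast hz n

/-- The division subring of the elements under which a sequence of subspaces is asymptotically
invariant. -/
def almostInvariant (V : ℕ → Submodule K D) (hfin : ∀ n, FiniteDimensional K (V n))
    (hpos : ∀ n, 0 < Module.finrank K (V n)) : Subfield D where
  carrier := {x | Tendsto (fun n => (Module.finrank K (addMul x (V n)) : ℝ) /
    Module.finrank K (V n)) atTop (𝓝 1)}
  one_mem' := by
    refine tendsto_const_nhds.congr fun n => ?_
    have := finrank_addMul_algebraMap (D := D) (1 : K) (V n)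
    rw [map_one] at this
    rw [this, div_self]
    exact_mod_cast (hpos n).ne'
  zero_mem' := by
    refine tendsto_const_nhds.congr fun n => ?_
    have := finrank_addMul_algebraMap (D := D) (0 : K) (V n)
    rw [map_zero] at this
    rw [this, div_self]
    exact_mod_cast (hpos n).ne'
  neg_mem' := by
    intro x hx
    refine hx.congr fun n => ?_
    have : addMul (-x) (V n) = addMul x (V n) := by
      have h : LinearMap.mulLeft K (-x) = -LinearMap.mulLeft K x := by ext; simp
      rw [addMul, addMul, h, Submodule.map_neg]
    rw [this]
  inv_mem' := by
    intro x hx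
    refine hx.congr fun n => ?_
    rw [finrank_addMul_inv]
  add_mem' := fun {x y} hx hy =>
    tendsto_addMul_div hfin hpos hx hy fun n => finrank_addMul_add x y (V n)
  mul_mem' := fun {x y} hx hy =>
    tendsto_addMul_div hfin hpos hx hy fun n => finrank_addMul_mul x y (V n)

/-- All the spaces `V + x i V` contain `V`, so by submodularity the excess dimensions over `V` at
most add up. -/
theorem finrank_sup_biSup_addMul {ι : Type*} (s : Finset ι) (x : ι → D) (V : Submodule K D)
    [FiniteDimensional K V] :
    FiniteDimensional K ↥(V ⊔ ⨆ i ∈ s, addMul (x i) V) ∧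
    (Module.finrank K ↥(V ⊔ ⨆ i ∈ s, addMul (x i) V) : ℝ) ≤ Module.finrank K V +
      ∑ i ∈ s, ((Module.finrank K (addMul (x i) V) : ℝ) - Module.finrank K V) := by
  classical
  induction s using Finset.induction_on with
  | empty =>
    have h : (V ⊔ ⨆ i ∈ (∅ : Finset ι), addMul (x i) V) = V := by simp
    rw [h, Finset.sum_empty, add_zero]
    exact ⟨inferInstance, le_rfl⟩
  | insert i s hi ih =>
    obtain ⟨hf, ih⟩ := ih
    rw [Finset.iSup_insert, sup_left_comm, Finset.sum_insert hi]
    refine ⟨inferInstance, ?_⟩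
    have h := finrank_sup_add_le (A := addMul (x i) V) (B := V ⊔ ⨆ i ∈ s, addMul (x i) V)
      (le_addMul _ _) le_sup_left
    have h' : (Module.finrank K ↥(addMul (x i) V ⊔ (V ⊔ ⨆ i ∈ s, addMul (x i) V)) : ℝ) +
      Module.finrank K V ≤ Module.finrank K (addMul (x i) V) +
        Module.finrank K ↥(V ⊔ ⨆ i ∈ s, addMul (x i) V) := by exact_mod_cast h
    linarith

/-- Subspaces of a skew field that are almost invariant under a generating set are almost
invariant under all elements. -/
theorem isAmenableSkewField_of_isGenerating {r : ℕ} {φ : FreeGrp r →* D} (hgen : IsGenerating K φ)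
    (h : ∀ ε : ℝ, 0 < ε → ∃ V : Submodule K D, FiniteDimensional K V ∧
      (Module.finrank K ↥(V ⊔ ⨆ i, V.map (LinearMap.mulLeft K (φ (FreeGroup.of i)))) : ℝ) <
        (1 + ε) * Module.finrank K V) :
    IsAmenableSkewField K D := by
  choose V hfin hV using fun n : ℕ => h (1 / ((n : ℝ) + 1)) Nat.one_div_pos_of_nat
  have hpos : ∀ n, 0 < Module.finrank K (V n) := fun n => Nat.pos_of_ne_zero fun h0 => by
    have := hV n
    rw [h0, Nat.cast_zero, mul_zero] at this
    exact absurd this (not_lt.2 (Nat.cast_nonneg _))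
  let S := almostInvariant V hfin hpos
  have hSK : ∀ c : K, algebraMap K D c ∈ S := fun c => by
    refine tendsto_const_nhds.congr fun n => ?_
    rw [finrank_addMul_algebraMap, div_self]
    exact_mod_cast (hpos n).ne'
  have hSof : ∀ i, φ (FreeGroup.of i) ∈ S := fun i => by
    have hlim : Tendsto (fun n : ℕ => 1 + 1 / ((n : ℝ) + 1)) atTop (𝓝 1) := by
      simpa using (tendsto_one_div_add_atTop_nhds_zero_nat (𝕜 := ℝ)).const_add 1
    refine tendsto_of_tendsto_of_tendsto_of_le_of_le tendsto_const_nhds hlim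
      (fun n => one_le_addMul_div _ (hpos n)) fun n => ?_
    have := hfin n
    dsimp only
    rw [div_le_iff₀ (Nat.cast_pos.2 (hpos n))]
    exact (Nat.cast_le.2 (Submodule.finrank_mono (sup_le_sup_left
      (le_iSup (fun i => (V n).map (LinearMap.mulLeft K (φ (FreeGroup.of i)))) i) _))).trans
      (hV n).le
  have hSφ : ∀ g, φ g ∈ S := fun g => by
    induction g using FreeGroup.induction_on with
    | C1 => rw [map_one]; exact S.one_mem
    | of i => exact hSof i
    | inv_of i _ =>
      have : φ (FreeGroup.of i)⁻¹ = (φ (FreeGroup.of i))⁻¹ :=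
        eq_inv_of_mul_eq_one_left (by rw [← map_mul, inv_mul_cancel, map_one])
      exact this ▸ S.inv_mem (hSof i)
    | mul g g' hg hg' => rw [map_mul]; exact S.mul_mem hg hg'
  have hS : ∀ x : D, x ∈ S := by
    have hle : Subfield.closure (Set.range (groupAlgHom (K := K) φ)) ≤ S := by
      rw [Subfield.closure_le]
      rintro _ ⟨a, rfl⟩
      rw [groupAlgHom, MonoidAlgebra.lift_apply]
      refine S.sum_mem fun g _ => ?_
      dsimp only
      rw [Algebra.smul_def]
      exact S.mul_mem (hSK _) (hSφ g)
    rw [IsGenerating] at hgen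
    rw [hgen] at hle
    exact fun x => hle (Subfield.mem_top x)
  intro ε hε E hE _
  let b := Module.finBasis K E
  have hlim : Tendsto (fun n => 1 + ∑ i, ((Module.finrank K (addMul (b i : D) (V n)) : ℝ) /
      Module.finrank K (V n) - 1)) atTop (𝓝 1) := by
    have := (tendsto_finsetSum Finset.univ fun i _ => (hS (b i)).sub_const 1).const_add (1 : ℝ)
    simpa using this
  obtain ⟨n, hn⟩ := (hlim.eventually_lt_const (show (1 : ℝ) < 1 + ε by linarith)).exists
  have := hfin n
  have hv : (0 : ℝ) < Module.finrank K (V n) := by exact_mod_cast hpos n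
  refine ⟨V n, this, ?_⟩
  obtain ⟨hf, hle⟩ := finrank_sup_biSup_addMul Finset.univ (fun i => (b i : D)) (V n)
  have hEV : E * V n ≤ V n ⊔ ⨆ i ∈ Finset.univ, addMul (b i : D) (V n) := by
    refine Submodule.mul_le.2 fun e he v hv => ?_
    have hsum : e = ∑ i, b.repr ⟨e, he⟩ i • (b i : D) := by
      have := congrArg E.subtype (b.sum_repr ⟨e, he⟩).symm
      rwa [map_sum] at this
    rw [hsum, Finset.sum_mul]
    refine Submodule.sum_mem _ fun i _ => ?_
    rw [smul_mul_assoc]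
    refine Submodule.smul_mem _ _ (Submodule.mem_sup_right ?_)
    refine (le_iSup₂_of_le (f := fun i (_ : i ∈ Finset.univ) => addMul (b i : D) (V n)) i
      (Finset.mem_univ i) le_rfl) ?_
    exact Submodule.mem_sup_right ⟨v, hv, rfl⟩
  refine lt_of_le_of_lt ((Nat.cast_le.2 (Submodule.finrank_mono hEV)).trans hle) ?_
  rw [← div_lt_iff₀ hv]
  refine lt_of_eq_of_lt ?_ hn
  rw [add_div, div_self hv.ne', Finset.sum_div]
  congr 1
  refine Finset.sum_congr rfl fun i _ => ?_
  rw [sub_div, div_self hv.ne']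

/-- Almost invariant subspaces of a left vector space over `D` give such subspaces of `D`. -/
theorem exists_almost_invariant_of_module {r : ℕ} {Q : Type*} [AddCommGroup Q] [Module D Q]
    [Module K Q] [IsScalarTower K D Q] (c : Fin r → D) {ε : ℝ} (V : Submodule K Q)
    [FiniteDimensional K V]
    (hV : (Module.finrank K ↥(V ⊔ ⨆ i, V.map (Algebra.lsmul K K Q (c i))) : ℝ) <
      (1 + ε) * Module.finrank K V) :
    ∃ W : Submodule K D, FiniteDimensional K W ∧
      (Module.finrank K ↥(W ⊔ ⨆ i, W.map (LinearMap.mulLeft K (c i))) : ℝ) <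
        (1 + ε) * Module.finrank K W := by
  induction hn : Module.finrank K V using Nat.strong_induction_on generalizing V with
  | _ n ih =>
  have hpos : V ≠ ⊥ := by
    rintro rfl
    rw [finrank_bot, Nat.cast_zero, mul_zero] at hV
    exact absurd hV (not_lt.2 (Nat.cast_nonneg _))
  obtain ⟨v, hv, hv0⟩ := Submodule.exists_mem_ne_zero_of_ne_bot hpos
  let B := Module.Basis.ofVectorSpace D Q
  -- A coordinate not vanishing on all of `V` makes its kernel in `V` strictly smaller, so the
  -- induction on dimension proceeds.
  obtain ⟨j, hj⟩ : ∃ j, B.repr v j ≠ 0 := by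
    by_contra! hcon
    exact hv0 (B.repr.map_eq_zero_iff.1 (Finsupp.ext hcon))
  let f : Q →ₗ[K] D := (B.coord j).restrictScalars K
  let N : Submodule K Q := V ⊔ ⨆ i, V.map (Algebra.lsmul K K Q (c i))
  have hNfin : FiniteDimensional K N := by
    dsimp only [N]
    infer_instance
  have hcomm : ∀ i, f ∘ₗ Algebra.lsmul K K Q (c i) = LinearMap.mulLeft K (c i) ∘ₗ f := fun i => by
    ext q
    simp [f]
  have hmap : N.map f = V.map f ⊔ ⨆ i, (V.map f).map (LinearMap.mulLeft K (c i)) := by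
    simp only [N, Submodule.map_sup, Submodule.map_iSup, ← Submodule.map_comp, hcomm]
  let V' : Submodule K Q := V ⊓ LinearMap.ker f
  have hV'fin : FiniteDimensional K V' := Submodule.finiteDimensional_of_le inf_le_left
  have hker : V' ⊔ ⨆ i, V'.map (Algebra.lsmul K K Q (c i)) ≤ N ⊓ LinearMap.ker f := by
    refine le_inf (sup_le_sup inf_le_left (iSup_mono fun i => Submodule.map_mono inf_le_left))
      (sup_le inf_le_right (iSup_le fun i => ?_))
    rintro _ ⟨q, hq, rfl⟩
    have hq' : f q = 0 := hq.2
    rw [LinearMap.mem_ker, ← LinearMap.comp_apply, hcomm, LinearMap.comp_apply, hq', map_zero]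
  have hNfin' : FiniteDimensional K ↥(N ⊓ LinearMap.ker f) :=
    Submodule.finiteDimensional_of_le inf_le_left
  have h₁ := finrank_map_add_finrank_inf_ker V f
  have h₂ := finrank_map_add_finrank_inf_ker N f
  have h₃ := Submodule.finrank_mono hker
  -- The dimensions of `V` and `N` split into image and kernel parts, so the strict inequality
  -- survives on at least one of the two.
  by_cases hW : (Module.finrank K (N.map f) : ℝ) < (1 + ε) * Module.finrank K (V.map f)
  · exact ⟨V.map f, inferInstance, by rwa [← hmap]⟩
  · refine ih (Module.finrank K V') ?_ V' ?_ rfl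
    · have hfv : f v ∈ V.map f := ⟨v, hv, rfl⟩
      have : 0 < Module.finrank K (V.map f) := Module.finrank_pos_iff_exists_ne_zero.2
        ⟨⟨f v, hfv⟩, fun h => hj (congrArg Subtype.val h)⟩
      have h₁' : Module.finrank K (V.map f) + Module.finrank K V' = Module.finrank K V := h₁
      omega
    · have h₁' : (Module.finrank K (V.map f) : ℝ) + Module.finrank K V' = Module.finrank K V := by
        exact_mod_cast h₁
      have h₂' : (Module.finrank K (N.map f) : ℝ) + Module.finrank K ↥(N ⊓ LinearMap.ker f) =
        Module.finrank K N := by exact_mod_cast h₂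
      have h₃' : (Module.finrank K ↥(V' ⊔ ⨆ i, V'.map (Algebra.lsmul K K Q (c i))) : ℝ) ≤
        Module.finrank K ↥(N ⊓ LinearMap.ker f) := by exact_mod_cast h₃
      have hV' : (Module.finrank K N : ℝ) < (1 + ε) * Module.finrank K V := hV
      rw [← h₁', mul_add] at hV'
      linarith [not_lt.1 hW]

end Amenable

/-! ### From hyperfiniteness to amenability. -/

section HyperfiniteModel

theorem exists_model_of_subspace {K : Type*} [Field K] {r d : ℕ}
    (θ : FreeGrp r →* Matrix (Fin d) (Fin d) K) (V : Submodule K (Fin d → K)) :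
    ∃ (V' : Submodule K (Fin (Module.finrank K (genSpan θ V)) → K))
      (g : Fin r → (Fin (Module.finrank K (genSpan θ V)) → K) →
        (Fin (Module.finrank K (genSpan θ V)) → K))
      (f : Fin (Module.finrank K (genSpan θ V)) → Fin d → K),
      Module.finrank K V' = Module.finrank K V ∧
      f ∈ LinearMap.ker (blockMap θ (relMatrix V' g)) ∧
      Function.Injective (Fintype.linearCombination K f) ∧
      LinearMap.range (Fintype.linearCombination K f) = genSpan θ V := by
  classical
  let W := genSpan θ V
  let β : (Fin (Module.finrank K W) → K) ≃ₗ[K] W := (Module.finBasis K W).equivFun.symm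
  let f : Fin (Module.finrank K W) → Fin d → K := fun b => Module.finBasis K W b
  have hβ : Fintype.linearCombination K f = W.subtype ∘ₗ β.toLinearMap := by
    refine LinearMap.ext fun w => ?_
    simp [β, f, Fintype.linearCombination_apply, Module.Basis.equivFun_symm_apply]
  have hinj : Function.Injective (Fintype.linearCombination K f) := by
    rw [hβ]
    exact W.injective_subtype.comp β.injective
  have hrange : LinearMap.range (Fintype.linearCombination K f) = W := by
    rw [hβ, LinearMap.range_comp_of_range_eq_top _ (LinearEquiv.range β), Submodule.range_subtype]
  have hVW : V ≤ W := le_sup_left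
  let V' := V.comap (Fintype.linearCombination K f)
  have hV' : V'.map (Fintype.linearCombination K f) = V := by
    rw [Submodule.map_comap_eq, hrange, inf_eq_right]
    exact hVW
  let g : Fin r → (Fin (Module.finrank K W) → K) → (Fin (Module.finrank K W) → K) := fun i u =>
    if h : (θ (FreeGroup.of i)).mulVec (Fintype.linearCombination K f u) ∈ W then β.symm ⟨_, h⟩
    else 0
  refine ⟨V', g, f, ?_, mem_ker_relMatrix.2 fun i v hv => ?_, hinj, hrange⟩
  · rw [(Submodule.equivMapOfInjective _ hinj V').finrank_eq, hV']
  · have hmem : (θ (FreeGroup.of i)).mulVec (Fintype.linearCombination K f v) ∈ W :=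
      (le_sup_of_le_right (le_iSup (fun i => V.map (Matrix.toLin' (θ (FreeGroup.of i)))) i) :
        _ ≤ W) ⟨_, hv, Matrix.toLin'_apply _ _⟩
    have hg : g i v = β.symm ⟨_, hmem⟩ := dif_pos hmem
    have h := LinearMap.congr_fun hβ (β.symm ⟨_, hmem⟩)
    rw [hg, h]
    simp

variable {K : Type*} [Field K] {r : ℕ}

/-- The combinatorial data of partial actions of the generators on spaces of dimension at most `L`
that enlarge the domain by a factor less than `1 + ε`. -/
abbrev ModelType (K : Type*) [Field K] (r L : ℕ) (ε : ℝ) : Type _ :=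
  {p : Σ l : Fin (L + 1), Submodule K (Fin l → K) × (Fin r → (Fin l → K) → (Fin l → K)) //
    ((p.1 : ℕ) : ℝ) < (1 + ε) * Module.finrank K p.2.1}

instance finite_modelType [Finite K] (L : ℕ) (ε : ℝ) : Finite (ModelType K r L ε) := by
  have : ∀ l : ℕ, Finite (Submodule K (Fin l → K)) := fun l =>
    Finite.of_injective (fun S => (S : Set (Fin l → K))) SetLike.coe_injective
  infer_instance

/-- Nonzero vectors picked from independent subspaces are linearly independent; here the vectors are
the images of `w` in the copies. -/
theorem card_le_finrank_solValues {d l : ℕ} {θ : FreeGrp r →* Matrix (Fin d) (Fin d) K}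
    {I J : Type*} [Fintype J] (P : Matrix I (Fin l) (MonoidAlgebra K (FreeGrp r)))
    {w : Fin l → K} (hw : w ≠ 0)
    (f : J → Fin l → Fin d → K) (hf : ∀ j, f j ∈ LinearMap.ker (blockMap θ P))
    (hinj : ∀ j, Function.Injective (Fintype.linearCombination K (f j)))
    (hind : iSupIndep fun j => LinearMap.range (Fintype.linearCombination K (f j))) :
    Fintype.card J ≤ Module.finrank K (solValues θ P w) := by
  have hli : LinearIndependent K fun j => Fintype.linearCombination K (f j) w :=
    hind.linearIndependent _ (fun j => ⟨w, rfl⟩) fun j h =>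
      hw (hinj j (h.trans (map_zero _).symm))
  rw [← finrank_span_eq_card hli]
  refine Submodule.finrank_mono (Submodule.span_le.2 ?_)
  rintro _ ⟨j, rfl⟩
  exact ⟨f j, hf j, evalAt_eq_linearCombination w (f j)⟩

variable {d : ℕ → ℕ} {θ : ∀ k, FreeGrp r →* Matrix (Fin (d k)) (Fin (d k)) K}
  {D : Type*} [DivisionRing D] [Algebra K D] {φ : FreeGrp r →* D}

theorem IsHyperfiniteSeq.exists_model [Finite K] (hd : ∀ k, 0 < d k) (hlim : IsLimitRep θ φ)
    (h : IsHyperfiniteSeq θ) {ε : ℝ} (hε : 0 < ε) :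
    ∃ (l : ℕ) (V : Submodule K (Fin l → K)) (g : Fin r → (Fin l → K) → (Fin l → K)),
      (l : ℝ) < (1 + ε) * Module.finrank K V ∧
      ∀ w : Fin l → K, w ≠ 0 → (fun b => algebraMap K D (w b)) ∉ rowSpan φ (relMatrix V g) := by
  classical
  by_contra! hcon
  -- The bound 1/2 keeps every model within size `2 * C` and makes the pieces fill at least half of
  -- the space, so at least `d k / (2 * C)` pieces occur.
  let η := min ε (1 / 2)
  have hη : 0 < η := lt_min hε (by norm_num)
  have hη2 : η ≤ 1 / 2 := min_le_right _ _
  obtain ⟨C, hC, hpieces⟩ := h η hη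
  have hCpos : (0 : ℝ) < C := Nat.cast_pos.2 hC
  let T := ModelType K r (2 * C) ε
  have := Fintype.ofFinite T
  choose w hw0 hw using fun τ : T => hcon _ τ.1.2.1 τ.1.2.2 τ.2
  have hsum : Tendsto (fun k => ∑ τ : T, (Module.finrank K
      (solValues (θ k) (relMatrix τ.1.2.1 τ.1.2.2) (w τ)) : ℝ) / d k) atTop (𝓝 0) := by
    simpa using tendsto_finsetSum Finset.univ fun τ _ => hlim.tendsto_zero (hw τ)
  obtain ⟨k, hk⟩ := (hsum.eventually_lt_const (show 0 < 1 / (2 * (C : ℝ)) by positivity)).exists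
  have hdk : (0 : ℝ) < d k := Nat.cast_pos.2 (hd k)
  obtain ⟨t, V, hVC, hind, hVlt, hVsum⟩ := hpieces k
  choose V' g f hV' hf hinj hrange using fun j => exists_model_of_subspace (θ k) (V j)
  have hlt : ∀ j, (Module.finrank K (genSpan (θ k) (V j)) : ℝ) <
      (1 + ε) * Module.finrank K (V' j) := fun j => by
    rw [hV']
    refine (hVlt j).trans_le ?_
    gcongr
    exact min_le_left _ _
  have hL : ∀ j, Module.finrank K (genSpan (θ k) (V j)) < 2 * C + 1 := fun j => by
    have h₁ : (Module.finrank K (V j) : ℝ) ≤ C := Nat.cast_le.2 (hVC j)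
    have h₂ : (Module.finrank K (genSpan (θ k) (V j)) : ℝ) < (2 * C + 1 : ℕ) := by
      refine (hVlt j).trans ?_
      push_cast
      nlinarith
    exact_mod_cast h₂
  let τ : Fin t → T := fun j => ⟨⟨⟨_, hL j⟩, V' j, g j⟩, hlt j⟩
  have hfib : ∀ σ : T, (Finset.univ.filter fun j => τ j = σ).card ≤
      Module.finrank K (solValues (θ k) (relMatrix σ.1.2.1 σ.1.2.2) (w σ)) := fun σ => by
    have hex : ∀ j : {j // τ j = σ}, ∃ f' : Fin σ.1.1 → Fin (d k) → K,
        f' ∈ LinearMap.ker (blockMap (θ k) (relMatrix σ.1.2.1 σ.1.2.2)) ∧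
        Function.Injective (Fintype.linearCombination K f') ∧
        LinearMap.range (Fintype.linearCombination K f') = genSpan (θ k) (V j) := by
      rintro ⟨j, rfl⟩
      exact ⟨f j, hf j, hinj j, hrange j⟩
    choose f' hf' hinj' hrange' using hex
    rw [← Fintype.card_subtype]
    refine card_le_finrank_solValues _ (hw0 σ) f' hf' hinj' ?_
    simp only [hrange']
    exact hind.comp Subtype.val_injective
  have ht : (t : ℝ) ≤ ∑ σ : T, (Module.finrank K
      (solValues (θ k) (relMatrix σ.1.2.1 σ.1.2.2) (w σ)) : ℝ) := by
    have h₁ := Finset.card_eq_sum_card_fiberwise (f := τ) (s := Finset.univ) (t := Finset.univ)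
      fun _ _ => Finset.mem_coe.2 (Finset.mem_univ _)
    rw [Finset.card_univ, Fintype.card_fin] at h₁
    exact_mod_cast h₁.trans_le (Finset.sum_le_sum fun σ _ => hfib σ)
  have htC : (1 - η) * d k ≤ t * C := by
    refine hVsum.trans ((Finset.sum_le_sum fun j _ => Nat.cast_le.2 (hVC j)).trans ?_)
    simp
  rw [← Finset.sum_div, div_lt_div_iff₀ hdk (by positivity)] at hk
  nlinarith

theorem exists_almost_invariant_of_model {l : ℕ} {V : Submodule K (Fin l → K)}
    {g : Fin r → (Fin l → K) → (Fin l → K)} {ε : ℝ}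
    (hV : (l : ℝ) < (1 + ε) * Module.finrank K V)
    (hrow : ∀ w : Fin l → K, w ≠ 0 →
      (fun b => algebraMap K D (w b)) ∉ rowSpan φ (relMatrix V g)) :
    ∃ W : Submodule K D, FiniteDimensional K W ∧
      (Module.finrank K ↥(W ⊔ ⨆ i, W.map (LinearMap.mulLeft K (φ (FreeGroup.of i)))) : ℝ) <
        (1 + ε) * Module.finrank K W := by
  -- This is the universal `D`-module solving the relations; by `hrow` the map from `K^l` into it is
  -- injective.
  let Q := (Fin l → D) ⧸ rowSpan φ (relMatrix V g)
  let ι : (Fin l → K) →ₗ[K] Q :=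
    ((rowSpan φ (relMatrix V g)).mkQ.restrictScalars K) ∘ₗ (Algebra.linearMap K D).compLeft (Fin l)
  have hι : Function.Injective ι := by
    rw [← LinearMap.ker_eq_bot, LinearMap.ker_eq_bot']
    intro w hw
    by_contra hw0
    exact hrow w hw0 ((Submodule.Quotient.mk_eq_zero _).1 hw)
  refine exists_almost_invariant_of_module (Q := Q) (fun i => φ (FreeGroup.of i)) (V.map ι) ?_
  have hle : V.map ι ⊔ ⨆ i, (V.map ι).map (Algebra.lsmul K K Q (φ (FreeGroup.of i))) ≤
      LinearMap.range ι := by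
    refine sup_le LinearMap.map_le_range (iSup_le fun i => ?_)
    rintro _ ⟨_, ⟨v, hv, rfl⟩, rfl⟩
    refine ⟨g i v, ?_⟩
    have hmem : ((relMatrix V g).map (groupAlgHom (K := K) φ)).row (i, ⟨v, hv⟩) ∈
      rowSpan φ (relMatrix V g) := Submodule.subset_span ⟨_, rfl⟩
    rw [row_groupAlgHom_relMatrix] at hmem
    exact ((Submodule.Quotient.eq _).2 hmem).symm
  refine lt_of_le_of_lt (Nat.cast_le.2 ((Submodule.finrank_mono hle).trans
    (LinearMap.finrank_range_le ι))) ?_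
  rwa [Module.finrank_fin_fun, ← (Submodule.equivMapOfInjective ι hι V).finrank_eq]

end HyperfiniteModel

end

theorem theorem3 {K : Type*} [Field K] [Finite K] {r : ℕ} {d : ℕ → ℕ} (hd : ∀ k, 0 < d k)
    (θ : ∀ k, FreeGrp r →* Matrix (Fin (d k)) (Fin (d k)) K)
    (hconv : IsConvergentSeq θ) (hAtiyah : AtiyahCondition θ)
    {D : Type*} [DivisionRing D] [Algebra K D] (φ : FreeGrp r →* D)
    (hlim : IsLimitRep θ φ) (hgen : IsGenerating K φ) :
    IsHyperfiniteSeq θ ↔ IsAmenableSkewField K D := by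
  refine ⟨fun h => isAmenableSkewField_of_isGenerating hgen fun ε hε => ?_,
    fun h => hlim.isHyperfiniteSeq hd h⟩
  obtain ⟨l, V, g, hV, hrow⟩ := h.exists_model hd hlim hε
  exact exists_almost_invariant_of_model hV hrow
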